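/- Let $d \ge 1$ and let $A, B \in \mathbb{R}^{d\times d}$ and $\Sigma \in \mathbb{R}^{2d\times 2d}$ be symmetric positive-definite matrices (i.e. full-rank covariance matrices), and let $\varepsilon > 0$. Let $\mu = N_d(A)$ and $\nu = N_d(B)$ be the centered Gaussian measures on $\mathbb{R}^d$ with covariance matrices $A$ and $B$, and let $N_{2d}(\Sigma)$ be the centered Gaussian measure on $\mathbb{R}^d\times\mathbb{R}^d$ with covariance matrix $\Sigma$. Let $\Pi(\mu,\nu)$ be the set of probability measures on $\mathbb{R}^d\times\mathbb{R}^d$ with first marginal $\mu$ and second marginal $\nu$, and let $\mathrm{KL}(\pi\,|\,\rho) := \int \log\left(\frac{d\pi}{d\rho}\right) d\pi$ if $\pi \ll \rho$ and $\mathrm{KL}(\pi\,|\,\rho) := +\infty$ otherwise. Then the regularized optimal transport problem $$\inf_{\pi\in\Pi(\mu,\nu)} \int_{\mathbb{R}^d\times\mathbb{R}^d} \|x-y\|^2\, d\pi(x,y) + 2\varepsilon\, \mathrm{KL}(\pi\,|\,N_{2d}(\Sigma))$$ has a unique solution, i.e. there is exactly one $\pi \in \Pi(\mu,\nu)$ at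 which the infimum is attained. -/

import Mathlib

open MeasureTheory ProbabilityTheory InformationTheory
open scoped ENNReal

noncomputable section

namespace GaussianEOT

/-- The centered Gaussian measure `N_d(A)` on `ℝ^d` with covariance matrix `A`. -/
def gaussian {d : ℕ} (A : Matrix (Fin d) (Fin d) ℝ) : Measure (EuclideanSpace ℝ (Fin d)) :=
  multivariateGaussian 0 A

/-- The centered Gaussian measure `N_{2d}(Σ)` on `ℝ^d × ℝ^d`. The rows and columns of the
`2d × 2d` covariance matrix are indexed by `Fin d ⊕ Fin d`: the left summand is the first factor
`ℝ^d`, the right summand is the second one. -/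
def gaussianProd {d : ℕ} (S : Matrix (Fin d ⊕ Fin d) (Fin d ⊕ Fin d) ℝ) :
    Measure (EuclideanSpace ℝ (Fin d) × EuclideanSpace ℝ (Fin d)) :=
  (multivariateGaussian 0 S).map
    (fun z => ((WithLp.toLp 2 fun i => z (Sum.inl i)), (WithLp.toLp 2 fun i => z (Sum.inr i))))

/-- The set `Π(μ, ν)` of couplings (transport plans) between `μ` and `ν`. -/
def couplings {d : ℕ} (μ ν : Measure (EuclideanSpace ℝ (Fin d))) :
    Set (Measure (EuclideanSpace ℝ (Fin d) × EuclideanSpace ℝ (Fin d))) :=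
  {π | IsProbabilityMeasure π ∧ π.map Prod.fst = μ ∧ π.map Prod.snd = ν}

/-- The objective `∫ ‖x - y‖² dπ(x, y) + 2 ε KL(π | πref)`, with values in `[0, +∞]`.
For probability measures, `klDiv π πref` is `∫ log (dπ/dπref) dπ` if `π ≪ πref` (it is `+∞` when
this integral diverges), and `+∞` otherwise. -/
def objective {d : ℕ} (ε : ℝ)
    (πref π : Measure (EuclideanSpace ℝ (Fin d) × EuclideanSpace ℝ (Fin d))) : ℝ≥0∞ :=
  (∫⁻ p, ENNReal.ofReal (‖p.1 - p.2‖ ^ 2) ∂π) + ENNReal.ofReal (2 * ε) * klDiv π πref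

/-- `π` solves the entropic optimal transport problem between `μ` and `ν` with reference `πref` and
regularization parameter `ε`: it is a coupling that minimizes the objective over all couplings. -/
def IsSolution {d : ℕ} (ε : ℝ)
    (πref : Measure (EuclideanSpace ℝ (Fin d) × EuclideanSpace ℝ (Fin d)))
    (μ ν : Measure (EuclideanSpace ℝ (Fin d)))
    (π : Measure (EuclideanSpace ℝ (Fin d) × EuclideanSpace ℝ (Fin d))) : Prop :=
  π ∈ couplings μ ν ∧ IsMinOn (objective ε πref) (couplings μ ν) π

end GaussianEOT

end

open Filter Topology

/-! ### Quantitative convexity of `klFun` -/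

namespace InformationTheory

/-! The entropy is uniformly convex for the Hellinger distance, the `L²(ρ)` distance between square
roots of densities: the convexity gap at a midpoint controls its square (`klFun_add_klFun_ge`,
integrated in `lintegral_add_klDiv_midpoint`). Adding the linear transport cost does not change this
gap, so near-minimizers are close to each other. Minimizing sequences are therefore Cauchy, and two
minimizers coincide.

Completeness of `L²` gives a limit `g`, and `g²` is the density of the candidate. Measures converge
on every measurable set, so marginals survive; Fatou gives lower semicontinuity. No weak compactness
is needed.

It remains to find one coupling of finite cost. The independent one works: its log-density relative
to the Gaussian reference is quadratic, and Gaussians have second moments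
(`klDiv_prod_gaussianProd_ne_top`). -/

lemma klFun_add_klFun_ge {a b : ℝ} (ha : 0 ≤ a) (hb : 0 ≤ b) :
    2 * klFun ((a + b) / 2) + (√a - √b) ^ 2 / 2 ≤ klFun a + klFun b := by
  set m := (a + b) / 2 with hm
  have hm0 : 0 ≤ m := by positivity
  -- This is `log u ≤ u - 1` at `u = √(m / t)`, multiplied by `2 * t`.
  have key : ∀ t, 0 ≤ t → (0 < t → 0 < m) → 2 * (t - √t * √m) ≤ t * Real.log t - t * Real.log m := by
    intro t ht htm
    rcases ht.eq_or_lt with rfl | ht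
    · simp
    have hm1 := htm ht
    have h1 := Real.log_le_sub_one_of_pos (x := √m / √t) (by positivity)
    rw [Real.log_div (by positivity) (by positivity), Real.log_sqrt hm0, Real.log_sqrt ht.le] at h1
    have h2 : t * (√m / √t) = √t * √m := by
      field_simp
      rw [Real.sq_sqrt ht.le]
    nlinarith [mul_le_mul_of_nonneg_left h1 ht.le]
  have ka := key a ha (fun h => by positivity)
  have kb := key b hb (fun h => by positivity)
  obtain ⟨x, hx, rfl⟩ : ∃ x, 0 ≤ x ∧ x ^ 2 = a := ⟨√a, by positivity, Real.sq_sqrt ha⟩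
  obtain ⟨y, hy, rfl⟩ : ∃ y, 0 ≤ y ∧ y ^ 2 = b := ⟨√b, by positivity, Real.sq_sqrt hb⟩
  rw [Real.sqrt_sq hx] at *
  rw [Real.sqrt_sq hy] at *
  have hs : √m ^ 2 = (x ^ 2 + y ^ 2) / 2 := Real.sq_sqrt hm0
  set s := √m
  have hs0 : 0 ≤ s := Real.sqrt_nonneg m
  have hxy : x + y ≤ 2 * s := by
    apply le_of_sq_le_sq _ (by positivity)
    nlinarith [sq_nonneg (x - y)]
  -- As `x² + y² = 2s²`, the right side is `(x - s)² + (y - s)²`.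
  have hmain : (x - y) ^ 2 / 2 ≤ 2 * (x ^ 2 + y ^ 2 - s * (x + y)) := by
    nlinarith [mul_nonneg (sub_nonneg.2 hxy) (add_nonneg hx hy), sq_nonneg (2 * s - (x + y))]
  simp only [klFun_apply]
  have : m = (x ^ 2 + y ^ 2) / 2 := hm
  have e : 2 * (m * Real.log m) = x ^ 2 * Real.log m + y ^ 2 * Real.log m := by rw [hm]; ring
  nlinarith

end InformationTheory

/-! ### Hellinger geometry and abstract minimization -/

namespace MeasureTheory

variable {X : Type*} [MeasurableSpace X]

/-- The square root of the density of `π` with respect to `ρ`. -/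
noncomputable def sqrtDensity (ρ π : Measure X) (x : X) : ℝ := √(π.rnDeriv ρ x).toReal

lemma measurable_sqrtDensity (ρ π : Measure X) : Measurable (sqrtDensity ρ π) :=
  (Measure.measurable_rnDeriv π ρ).ennreal_toReal.sqrt

lemma enorm_sqrtDensity_sq (ρ π : Measure X) [SigmaFinite π] :
    ∀ᵐ x ∂ρ, ‖sqrtDensity ρ π x‖ₑ ^ 2 = π.rnDeriv ρ x := by
  filter_upwards [Measure.rnDeriv_lt_top π ρ] with x hx
  rw [sqrtDensity, Real.enorm_of_nonneg (Real.sqrt_nonneg _),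
    ← ENNReal.ofReal_pow (Real.sqrt_nonneg _), Real.sq_sqrt ENNReal.toReal_nonneg,
    ENNReal.ofReal_toReal hx.ne]

lemma eLpNorm_two_sq {μ : Measure X} (f : X → ℝ) :
    eLpNorm f 2 μ ^ 2 = ∫⁻ x, ‖f x‖ₑ ^ 2 ∂μ := by
  rw [eLpNorm_eq_lintegral_rpow_enorm_toReal (by norm_num) (by norm_num)]
  simp only [ENNReal.toReal_ofNat, ENNReal.rpow_ofNat]
  rw [← ENNReal.rpow_natCast, ← ENNReal.rpow_mul]
  simp

/-- Allowing any `s` lets `L²` convergence of square roots be read as setwise convergence of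
measures. -/
lemma eLpNorm_sqrtDensity_sq (ρ π : Measure X) [SigmaFinite ρ] [SigmaFinite π] (h : π ≪ ρ)
    (s : Set X) :
    eLpNorm (sqrtDensity ρ π) 2 (ρ.restrict s) ^ 2 = π s := by
  rw [eLpNorm_two_sq, ← Measure.setLIntegral_rnDeriv h s]
  exact lintegral_congr_ae (ae_restrict_of_ae (enorm_sqrtDensity_sq ρ π))

lemma memLp_sqrtDensity (ρ π : Measure X) [SigmaFinite ρ] [IsFiniteMeasure π] (h : π ≪ ρ) :
    MemLp (sqrtDensity ρ π) 2 ρ := by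
  refine ⟨(measurable_sqrtDensity ρ π).aestronglyMeasurable, ?_⟩
  have := eLpNorm_sqrtDensity_sq ρ π h Set.univ
  rw [Measure.restrict_univ] at this
  by_contra hcon
  rw [not_lt, top_le_iff] at hcon
  rw [hcon] at this
  exact measure_ne_top π Set.univ (by simpa using this.symm)

/-- Convergence of `L²` norms under `L²` convergence. -/
lemma tendsto_eLpNorm_of_tendsto_eLpNorm_sub {μ : Measure X} {f : ℕ → X → ℝ} {g : X → ℝ}
    (hf : ∀ n, MemLp (f n) 2 μ) (hg : MemLp g 2 μ)
    (h : Tendsto (fun n => eLpNorm (f n - g) 2 μ) atTop (𝓝 0)) :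
    Tendsto (fun n => eLpNorm (f n) 2 μ) atTop (𝓝 (eLpNorm g 2 μ)) := by
  have h1 : Tendsto (fun n => eLpNorm g 2 μ - eLpNorm (f n - g) 2 μ) atTop
      (𝓝 (eLpNorm g 2 μ)) := by
    simpa using ENNReal.Tendsto.sub (tendsto_const_nhds (x := eLpNorm g 2 μ)) h (Or.inl hg.2.ne)
  have h2 : Tendsto (fun n => eLpNorm g 2 μ + eLpNorm (f n - g) 2 μ) atTop
      (𝓝 (eLpNorm g 2 μ)) := by
    simpa using (tendsto_const_nhds (x := eLpNorm g 2 μ)).add h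
  refine tendsto_of_tendsto_of_tendsto_of_le_of_le h1 h2 (fun n => ?_) (fun n => ?_)
  · rw [tsub_le_iff_right]
    have := eLpNorm_sub_le (f := f n) (g := f n - g) (p := 2) (μ := μ) (hf n).1
      ((hf n).1.sub hg.1) (by norm_num)
    simpa using this
  · have := eLpNorm_add_le (f := g) (g := f n - g) (p := 2) (μ := μ) hg.1
      ((hf n).1.sub hg.1) (by norm_num)
    simpa using this

/-- The functional `π ↦ ∫ c dπ + k KL(π | ρ)`, written in terms of a density `f` of `π`. -/
noncomputable def entropicCost (ρ : Measure X) (c : X → ℝ≥0∞) (k : ℝ≥0∞) (f : X → ℝ≥0∞) : ℝ≥0∞ :=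
  ∫⁻ x, (c x * f x + k * ENNReal.ofReal (klFun (f x).toReal)) ∂ρ

lemma entropicCost_congr {ρ : Measure X} {c : X → ℝ≥0∞} {k : ℝ≥0∞} {f g : X → ℝ≥0∞}
    (h : f =ᵐ[ρ] g) : entropicCost ρ c k f = entropicCost ρ c k g :=
  lintegral_congr_ae (by filter_upwards [h] with x hx; rw [hx])

lemma lintegral_add_klDiv_eq_entropicCost {ρ π : Measure X} [IsFiniteMeasure ρ]
    [IsFiniteMeasure π] {c : X → ℝ≥0∞} (hc : Measurable c) (k : ℝ≥0∞) (h : π ≪ ρ) :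
    ∫⁻ x, c x ∂π + k * klDiv π ρ = entropicCost ρ c k (π.rnDeriv ρ) := by
  rw [entropicCost, lintegral_add_left (f := fun x => c x * π.rnDeriv ρ x)
    (hc.mul (Measure.measurable_rnDeriv π ρ)),
    klDiv_eq_lintegral_klFun_of_ac h, lintegral_const_mul _ (by fun_prop)]
  congr 1
  rw [← lintegral_rnDeriv_mul h hc.aemeasurable]
  simp_rw [mul_comm]

lemma entropicCost_midpoint {ρ : Measure X} {c : X → ℝ≥0∞} {k : ℝ≥0∞} (hc : Measurable c)
    {f g : X → ℝ≥0∞} (hf : Measurable f) (hg : Measurable g) (hf' : ∀ᵐ x ∂ρ, f x < ∞)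
    (hg' : ∀ᵐ x ∂ρ, g x < ∞) :
    2 * entropicCost ρ c k (fun x => 2⁻¹ * (f x + g x)) +
      k / 2 * ∫⁻ x, ‖√(f x).toReal - √(g x).toReal‖ₑ ^ 2 ∂ρ ≤
      entropicCost ρ c k f + entropicCost ρ c k g := by
  have mf : Measurable fun x => c x * f x + k * ENNReal.ofReal (klFun (f x).toReal) := by fun_prop
  have mm : Measurable fun x => c x * (2⁻¹ * (f x + g x)) +
    k * ENNReal.ofReal (klFun (2⁻¹ * (f x + g x)).toReal) := by fun_prop
  have md : Measurable fun x => ‖√(f x).toReal - √(g x).toReal‖ₑ ^ 2 :=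
    ((hf.ennreal_toReal.sqrt.sub hg.ennreal_toReal.sqrt).enorm).pow_const 2
  unfold entropicCost
  rw [← lintegral_add_left mf, ← lintegral_const_mul _ mm, ← lintegral_const_mul _ md,
    ← lintegral_add_left (mm.const_mul 2)]
  refine lintegral_mono_ae ?_
  filter_upwards [hf', hg'] with x hx hy
  have h1 : 2 * (c x * (2⁻¹ * (f x + g x))) = c x * f x + c x * g x := by
    rw [← mul_add, mul_left_comm 2, ← mul_assoc 2, ENNReal.mul_inv_cancel (by norm_num)
      (by norm_num), one_mul]
  have h2 : 2 * ENNReal.ofReal (klFun (2⁻¹ * (f x + g x)).toReal) +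
      2⁻¹ * ‖√(f x).toReal - √(g x).toReal‖ₑ ^ 2 ≤
      ENNReal.ofReal (klFun (f x).toReal) + ENNReal.ofReal (klFun (g x).toReal) := by
    have ha : (0:ℝ) ≤ (f x).toReal := ENNReal.toReal_nonneg
    have hb : (0:ℝ) ≤ (g x).toReal := ENNReal.toReal_nonneg
    have hm : (2⁻¹ * (f x + g x)).toReal = ((f x).toReal + (g x).toReal) / 2 := by
      rw [ENNReal.toReal_mul, ENNReal.toReal_add hx.ne hy.ne]
      simp; ring
    have hkm : 0 ≤ klFun (((f x).toReal + (g x).toReal) / 2) := klFun_nonneg (by positivity)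
    have h2' : (2 : ℝ≥0∞) = ENNReal.ofReal 2 := by simp
    rw [hm, ← ENNReal.ofReal_add (klFun_nonneg ha) (klFun_nonneg hb), Real.enorm_eq_ofReal_abs,
      ← ENNReal.ofReal_pow (abs_nonneg _), sq_abs, h2', ← ENNReal.ofReal_inv_of_pos (by norm_num),
      ← ENNReal.ofReal_mul (by norm_num), ← ENNReal.ofReal_mul (by norm_num),
      ← ENNReal.ofReal_add (by positivity) (by positivity)]
    apply ENNReal.ofReal_le_ofReal
    have := klFun_add_klFun_ge ha hb
    linarith
  calc _ = (c x * f x + c x * g x) + k * (2 * ENNReal.ofReal (klFun (2⁻¹ * (f x + g x)).toReal) +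
      2⁻¹ * ‖√(f x).toReal - √(g x).toReal‖ₑ ^ 2) := by
        rw [mul_add 2, h1, ENNReal.div_eq_inv_mul]; ring
    _ ≤ (c x * f x + c x * g x) + k * (ENNReal.ofReal (klFun (f x).toReal) +
        ENNReal.ofReal (klFun (g x).toReal)) := by gcongr
    _ = _ := by ring

lemma lintegral_add_klDiv_midpoint {ρ π₁ π₂ : Measure X} [IsFiniteMeasure ρ]
    [IsFiniteMeasure π₁] [IsFiniteMeasure π₂] {c : X → ℝ≥0∞} (hc : Measurable c) (k : ℝ≥0∞)
    (h₁ : π₁ ≪ ρ) (h₂ : π₂ ≪ ρ) :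
    2 * (∫⁻ x, c x ∂((2⁻¹ : ℝ≥0∞) • (π₁ + π₂)) + k * klDiv ((2⁻¹ : ℝ≥0∞) • (π₁ + π₂)) ρ) +
      k / 2 * eLpNorm (sqrtDensity ρ π₁ - sqrtDensity ρ π₂) 2 ρ ^ 2 ≤
      (∫⁻ x, c x ∂π₁ + k * klDiv π₁ ρ) + (∫⁻ x, c x ∂π₂ + k * klDiv π₂ ρ) := by
  have : IsFiniteMeasure ((2⁻¹ : ℝ≥0∞) • (π₁ + π₂)) := Measure.smul_finite _ (by norm_num)
  have h12 : (2⁻¹ : ℝ≥0∞) • (π₁ + π₂) ≪ ρ := (h₁.add_left h₂).smul_left _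
  rw [lintegral_add_klDiv_eq_entropicCost hc k h₁, lintegral_add_klDiv_eq_entropicCost hc k h₂,
    lintegral_add_klDiv_eq_entropicCost hc k h12, eLpNorm_two_sq]
  have hd : ((2⁻¹ : ℝ≥0∞) • (π₁ + π₂)).rnDeriv ρ =ᵐ[ρ]
      fun x => 2⁻¹ * (π₁.rnDeriv ρ x + π₂.rnDeriv ρ x) := by
    filter_upwards [Measure.rnDeriv_smul_left_of_ne_top (π₁ + π₂) ρ (r := 2⁻¹) (by norm_num),
      Measure.rnDeriv_add π₁ π₂ ρ] with x hx hy
    rw [hx, Pi.smul_apply, hy, Pi.add_apply, smul_eq_mul]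
  rw [entropicCost_congr hd]
  exact entropicCost_midpoint hc (Measure.measurable_rnDeriv _ _) (Measure.measurable_rnDeriv _ _)
    (Measure.rnDeriv_lt_top _ _) (Measure.rnDeriv_lt_top _ _)

/-- Fatou, with an integrand continuous in the density; finiteness of `c` and `k` keeps
multiplication continuous in `ℝ≥0∞`, even at limit `0`. -/
lemma entropicCost_le_liminf {ρ : Measure X} {c : X → ℝ≥0∞} {k : ℝ≥0∞} (hc : Measurable c)
    (hc' : ∀ x, c x ≠ ∞) (hk : k ≠ ∞) {f : ℕ → X → ℝ≥0∞} {g : X → ℝ≥0∞}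
    (hf : ∀ n, Measurable (f n)) (hg : ∀ᵐ x ∂ρ, g x < ∞)
    (h : ∀ᵐ x ∂ρ, Tendsto (fun n => f n x) atTop (𝓝 (g x))) :
    entropicCost ρ c k g ≤ liminf (fun n => entropicCost ρ c k (f n)) atTop := by
  unfold entropicCost
  refine le_trans (lintegral_mono_ae ?_) (lintegral_liminf_le (fun n => ?_))
  · filter_upwards [hg, h] with x hx hlim
    refine le_of_eq (Tendsto.liminf_eq ?_).symm
    refine (ENNReal.Tendsto.const_mul hlim (Or.inr (hc' x))).add
      (ENNReal.Tendsto.const_mul ?_ (Or.inr hk))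
    exact (ENNReal.continuous_ofReal.tendsto _).comp
      ((continuous_klFun.tendsto _).comp ((ENNReal.tendsto_toReal hx.ne).comp hlim))
  · have := hf n
    fun_prop

/-- A set of probability measures that is stable under midpoints and setwise limits contains exactly
one minimizer of `π ↦ ∫ c dπ + k KL(π | ρ)`, provided this functional is finite somewhere on it. -/
theorem existsUnique_isMinOn_lintegral_add_klDiv (ρ : Measure X) [IsFiniteMeasure ρ]
    {c : X → ℝ≥0∞} (hc : Measurable c) (hc' : ∀ x, c x ≠ ∞) {k : ℝ≥0∞} (hk0 : k ≠ 0) (hk : k ≠ ∞)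
    (C : Set (Measure X)) (hprob : ∀ π ∈ C, IsProbabilityMeasure π)
    (hmid : ∀ π₁ ∈ C, ∀ π₂ ∈ C, (2⁻¹ : ℝ≥0∞) • (π₁ + π₂) ∈ C)
    (hclosed : ∀ (u : ℕ → Measure X) (π : Measure X), (∀ n, u n ∈ C) →
      (∀ s, MeasurableSet s → Tendsto (fun n => u n s) atTop (𝓝 (π s))) → π ∈ C)
    (hfin : ∃ π ∈ C, ∫⁻ x, c x ∂π + k * klDiv π ρ ≠ ∞) :
    ∃! π, π ∈ C ∧ IsMinOn (fun π => ∫⁻ x, c x ∂π + k * klDiv π ρ) C π := by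
  set J : Measure X → ℝ≥0∞ := fun π => ∫⁻ x, c x ∂π + k * klDiv π ρ with hJ
  have hac : ∀ π, J π ≠ ∞ → π ≪ ρ := by
    intro π hπ
    by_contra hcon
    exact hπ (by simp [hJ, klDiv_of_not_ac hcon, ENNReal.mul_top hk0])
  have hk2 : k / 2 ≠ 0 := by simp [hk0]
  have hk2' : k / 2 ≠ ∞ := ENNReal.div_ne_top hk (by norm_num)
  set m := ⨅ π ∈ C, J π with hm
  have hmle : ∀ π ∈ C, m ≤ J π := fun π hπ => iInf₂_le π hπ
  obtain ⟨π₀, hπ₀, hπ₀fin⟩ := hfin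
  have hmtop : m ≠ ∞ := ne_top_of_le_ne_top hπ₀fin (hmle π₀ hπ₀)
  -- The midpoint lies in `C`, so its value is at least `m`; cancelling `2 * m` leaves the Hellinger
  -- term.
  have hgap : ∀ π₁ ∈ C, ∀ π₂ ∈ C, ∀ δ : ℝ≥0∞, δ ≠ ∞ → J π₁ ≤ m + δ → J π₂ ≤ m + δ →
      k / 2 * eLpNorm (sqrtDensity ρ π₁ - sqrtDensity ρ π₂) 2 ρ ^ 2 ≤ 2 * δ := by
    intro π₁ h₁ π₂ h₂ δ hδ hJ₁ hJ₂
    have := hprob _ h₁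
    have := hprob _ h₂
    have hmδ : m + δ ≠ ∞ := ENNReal.add_ne_top.2 ⟨hmtop, hδ⟩
    have h := lintegral_add_klDiv_midpoint hc k (hac π₁ (ne_top_of_le_ne_top hmδ hJ₁))
      (hac π₂ (ne_top_of_le_ne_top hmδ hJ₂))
    have h2m : 2 * m ≠ ∞ := ENNReal.mul_ne_top (by norm_num) hmtop
    refine (ENNReal.add_le_add_iff_left h2m).1 ?_
    calc _ ≤ 2 * J ((2⁻¹ : ℝ≥0∞) • (π₁ + π₂)) +
          k / 2 * eLpNorm (sqrtDensity ρ π₁ - sqrtDensity ρ π₂) 2 ρ ^ 2 := by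
            gcongr; exact hmle _ (hmid _ h₁ _ h₂)
      _ ≤ J π₁ + J π₂ := h
      _ ≤ (m + δ) + (m + δ) := by gcongr
      _ = _ := by ring
  have hmin : ∀ π, π ∈ C → (IsMinOn J C π ↔ J π ≤ m) := by
    intro π hπ
    rw [isMinOn_iff]
    exact le_iInf₂_iff.symm
  have hex : ∃ π ∈ C, J π ≤ m := by
    -- With `k / 8`, `hgap` bounds the squared distance by half of `((1 / 2) ^ N) ^ 2`, which gives
    -- the strict inequality in `hcau`.
    let δ : ℕ → ℝ≥0∞ := fun n => k / 8 * ((1 / 2) ^ n) ^ 2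
    have hδ0 : ∀ n, δ n ≠ 0 := fun n => by simp [δ, hk0]
    have hδt : ∀ n, δ n ≠ ∞ := fun n =>
      ENNReal.mul_ne_top (ENNReal.div_ne_top hk (by norm_num)) (by simp)
    have hδanti : ∀ N n, N ≤ n → δ n ≤ δ N := by
      intro N n hNn
      have : (1 / 2 : ℝ≥0∞) ^ n ≤ (1 / 2) ^ N :=
        pow_le_pow_of_le_one (by simp) (by simp) hNn
      simp only [δ]
      gcongr
    have hch : ∀ n, ∃ π ∈ C, J π ≤ m + δ n := by
      intro n
      have hlt : m < m + δ n := ENNReal.lt_add_right hmtop (hδ0 n)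
      simp only [hm, iInf_lt_iff, exists_prop] at hlt
      obtain ⟨π, hπ, hlt⟩ := hlt
      exact ⟨π, hπ, hlt.le⟩
    choose u huC huJ using hch
    have hup : ∀ n, IsProbabilityMeasure (u n) := fun n => hprob _ (huC n)
    have hua : ∀ n, u n ≪ ρ := fun n =>
      hac _ (ne_top_of_le_ne_top (ENNReal.add_ne_top.2 ⟨hmtop, hδt n⟩) (huJ n))
    have hmem : ∀ n, MemLp (sqrtDensity ρ (u n)) 2 ρ := fun n => memLp_sqrtDensity ρ _ (hua n)
    have hcau : ∀ N n p : ℕ, N ≤ n → N ≤ p →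
        eLpNorm (sqrtDensity ρ (u n) - sqrtDensity ρ (u p)) 2 ρ < (1 / 2 : ℝ≥0∞) ^ N := by
      intro N n p hn hp
      have h := hgap _ (huC n) _ (huC p) (δ N) (hδt N)
        ((huJ n).trans (by gcongr; exact hδanti N n hn))
        ((huJ p).trans (by gcongr; exact hδanti N p hp))
      by_contra! hcon
      have h1 : k / 2 * ((1 / 2 : ℝ≥0∞) ^ N) ^ 2 ≤ 2 * δ N := le_trans (by gcongr) h
      have h2 : 2 * δ N = k / 4 * ((1 / 2 : ℝ≥0∞) ^ N) ^ 2 := by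
        simp only [δ]
        rw [← mul_assoc]
        congr 1
        rw [show (8 : ℝ≥0∞) = 2 * 4 by norm_num, div_eq_mul_inv, div_eq_mul_inv,
          ENNReal.mul_inv (by norm_num) (by norm_num), mul_left_comm, ← mul_assoc 2,
          ENNReal.mul_inv_cancel (by norm_num) (by norm_num), one_mul]
      rw [h2] at h1
      have h3 : k / 2 ≤ k / 4 := (ENNReal.mul_le_mul_iff_left (by simp) (by simp)).1 h1
      have h4 : (2 : ℝ≥0∞)⁻¹ ≤ 4⁻¹ := (ENNReal.mul_le_mul_iff_right hk0 hk).1 h3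
      rw [ENNReal.inv_le_inv] at h4
      norm_num at h4
    obtain ⟨g, hg, hlim⟩ := Lp.cauchy_complete_eLpNorm (by norm_num) hmem
      (B := fun N => (1 / 2 : ℝ≥0∞) ^ N) (by
        simp [ENNReal.tsum_geometric]) hcau
    -- The a.e. convergent subsequence serves only Fatou; setwise convergence holds for the whole
    -- sequence.
    obtain ⟨φ, hφ, hae⟩ := (tendstoInMeasure_of_tendsto_eLpNorm (by norm_num)
      (fun n => (hmem n).1) hg.1 hlim).exists_seq_tendsto_ae
    have hset : ∀ s, MeasurableSet s →
        Tendsto (fun n => u n s) atTop (𝓝 (ρ.withDensity (fun x => ‖g x‖ₑ ^ 2) s)) := by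
      intro s hs
      rw [withDensity_apply _ hs, ← eLpNorm_two_sq]
      simp_rw [← fun n => eLpNorm_sqrtDensity_sq ρ (u n) (hua n) s]
      refine ENNReal.Tendsto.pow (tendsto_eLpNorm_of_tendsto_eLpNorm_sub
        (fun n => (hmem n).restrict s) (hg.restrict s) ?_)
      exact tendsto_of_tendsto_of_tendsto_of_le_of_le tendsto_const_nhds hlim (fun _ => zero_le)
        (fun n => eLpNorm_mono_measure _ Measure.restrict_le_self)
    have hC := hclosed u _ huC hset
    have := hprob _ hC
    refine ⟨_, hC, ?_⟩
    have hgm : AEMeasurable (fun x => ‖g x‖ₑ ^ 2) ρ := hg.1.aemeasurable.enorm.pow_const 2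
    calc J (ρ.withDensity (fun x => ‖g x‖ₑ ^ 2))
        = entropicCost ρ c k (fun x => ‖g x‖ₑ ^ 2) :=
          (lintegral_add_klDiv_eq_entropicCost hc k (withDensity_absolutelyContinuous _ _)).trans
            (entropicCost_congr (Measure.rnDeriv_withDensity₀ ρ hgm))
      _ ≤ liminf (fun n => entropicCost ρ c k ((u (φ n)).rnDeriv ρ)) atTop := by
          refine entropicCost_le_liminf hc hc' hk (fun n => Measure.measurable_rnDeriv _ _)
            (ae_of_all _ fun x => by simp) ?_
          filter_upwards [hae, ae_all_iff.2 (fun n => enorm_sqrtDensity_sq ρ (u n))] with x hx hd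
          simp_rw [← hd]
          exact ENNReal.Tendsto.pow ((continuous_enorm.tendsto _).comp hx)
      _ = liminf (fun n => J (u (φ n))) atTop := by
          congr 1
          ext n
          exact (lintegral_add_klDiv_eq_entropicCost hc k (hua _)).symm
      _ ≤ liminf (fun n => m + δ (φ n)) atTop :=
          liminf_le_liminf (Eventually.of_forall fun n => huJ _)
      _ = m := by
          refine Tendsto.liminf_eq ?_
          have h0 : Tendsto δ atTop (𝓝 0) := by
            have h1 : Tendsto (fun n : ℕ => (1 / 2 : ℝ≥0∞) ^ n) atTop (𝓝 0) :=
              ENNReal.tendsto_pow_atTop_nhds_zero_of_lt_one (by simp)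
            have h2 := ENNReal.Tendsto.const_mul (a := k / 8) (ENNReal.Tendsto.pow (n := 2) h1)
              (Or.inr (ENNReal.div_ne_top hk (by norm_num)))
            simpa [δ] using h2
          simpa using (tendsto_const_nhds (x := m)).add (h0.comp hφ.tendsto_atTop)
  obtain ⟨π, hπ, hπm⟩ := hex
  refine ⟨π, ⟨hπ, (hmin π hπ).2 hπm⟩, ?_⟩
  rintro π' ⟨hπ', hπm'⟩
  replace hπm' := (hmin π' hπ').1 hπm'
  -- Uniqueness is the case `δ = 0`: the square roots of the densities agree a.e.
  have h := hgap π' hπ' π hπ 0 (by simp) (by simpa using hπm') (by simpa using hπm)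
  have := hprob _ hπ
  have := hprob _ hπ'
  have hπa := hac π (ne_top_of_le_ne_top hmtop hπm)
  have hπa' := hac π' (ne_top_of_le_ne_top hmtop hπm')
  have h0 : eLpNorm (sqrtDensity ρ π' - sqrtDensity ρ π) 2 ρ = 0 := by
    rw [mul_zero, nonpos_iff_eq_zero, mul_eq_zero] at h
    simpa using h.resolve_left hk2
  rw [eLpNorm_eq_zero_iff ((memLp_sqrtDensity ρ _ hπa').1.sub (memLp_sqrtDensity ρ _ hπa).1)
    (by norm_num)] at h0
  rw [← Measure.withDensity_rnDeriv_eq π' ρ hπa', ← Measure.withDensity_rnDeriv_eq π ρ hπa]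
  refine withDensity_congr_ae ?_
  filter_upwards [h0, enorm_sqrtDensity_sq ρ π, enorm_sqrtDensity_sq ρ π'] with x hx h1 h2
  rw [← h1, ← h2, sub_eq_zero.1 hx]

end MeasureTheory

/-! ### Finite divergence from log-densities -/

namespace InformationTheory

variable {X : Type*} [MeasurableSpace X]

/-- Two finite measures with positive densities have finite divergence as soon as the difference of
the log-densities is integrable. -/
lemma klDiv_withDensity_ne_top {ν : Measure X} {p q : X → ℝ}
    (hp : Measurable p) (hq : Measurable q) (hp0 : ∀ x, 0 < p x) (hq0 : ∀ x, 0 < q x)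
    [IsFiniteMeasure (ν.withDensity fun x => ENNReal.ofReal (p x))]
    [IsFiniteMeasure (ν.withDensity fun x => ENNReal.ofReal (q x))]
    (h : Integrable (fun x => Real.log (p x) - Real.log (q x))
      (ν.withDensity fun x => ENNReal.ofReal (p x))) :
    klDiv (ν.withDensity fun x => ENNReal.ofReal (p x))
      (ν.withDensity fun x => ENNReal.ofReal (q x)) ≠ ∞ := by
  set π := ν.withDensity fun x => ENNReal.ofReal (p x) with hπ
  set ρ := ν.withDensity fun x => ENNReal.ofReal (q x) with hρ
  have heq : π = ρ.withDensity fun x => ENNReal.ofReal (p x / q x) := by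
    rw [hρ, ← withDensity_mul (g := fun x => ENNReal.ofReal (p x / q x)) _
      hq.ennreal_ofReal (hp.div hq).ennreal_ofReal, hπ]
    congr 1
    ext x
    rw [Pi.mul_apply, ← ENNReal.ofReal_mul (hq0 x).le, mul_div_cancel₀ _ (hq0 x).ne']
  have hac : π ≪ ρ := heq ▸ withDensity_absolutelyContinuous _ _
  refine klDiv_ne_top hac (h.congr ?_)
  have hd : π.rnDeriv ρ =ᵐ[ρ] fun x => ENNReal.ofReal (p x / q x) := by
    rw [heq]
    exact Measure.rnDeriv_withDensity ρ (hp.div hq).ennreal_ofReal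
  filter_upwards [hac.ae_le hd] with x hx
  rw [llr, hx, ENNReal.toReal_ofReal (div_pos (hp0 x) (hq0 x)).le,
    Real.log_div (hp0 x).ne' (hq0 x).ne']

end InformationTheory

/-! ### Densities and second moments of Gaussians -/

namespace ProbabilityTheory

variable {E : Type*} [NormedAddCommGroup E] [InnerProductSpace ℝ E] [FiniteDimensional ℝ E]
  [MeasurableSpace E] [BorelSpace E]
  {F : Type*} [NormedAddCommGroup F] [NormedSpace ℝ F] [FiniteDimensional ℝ F]
  [MeasurableSpace F] [BorelSpace F]

variable (E) in
-- Both sides have the same characteristic function, by the Fourier integral of `exp (-‖x‖² / 2)`.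
-- The prefactor of that formula is identified with the total mass `I` at `t = 0`, so `K = I⁻¹`.
lemma stdGaussian_eq_withDensity : ∃ K : ℝ, 0 < K ∧
    stdGaussian E = volume.withDensity (fun x => ENNReal.ofReal (K * Real.exp (-‖x‖ ^ 2 / 2))) := by
  have hb : 0 < ((1 / 2 : ℂ)).re := by norm_num
  have hexp : ∀ t : E, ∫ x : E, Complex.exp (inner ℝ x t * Complex.I) *
      (Real.exp (-‖x‖ ^ 2 / 2) : ℂ) = (Real.pi / (1 / 2 : ℂ)) ^ (Module.finrank ℝ E / 2 : ℂ) *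
        Complex.exp (-‖t‖ ^ 2 / 2) := by
    intro t
    have h := GaussianFourier.integral_cexp_neg_mul_sq_norm_add (V := E) hb Complex.I t
    convert h using 1
    · congr 1
      ext x
      rw [Complex.ofReal_exp, ← Complex.exp_add, real_inner_comm]
      congr 1
      push_cast
      ring
    · rw [Complex.I_sq]
      congr 2
      ring
  have hint : Integrable (fun x : E => Real.exp (-‖x‖ ^ 2 / 2)) := by
    have h := (GaussianFourier.integrable_cexp_neg_mul_sq_norm_add (V := E) hb 0 0).re
    refine h.congr (ae_of_all _ fun x => ?_)
    simp only [zero_mul, add_zero, RCLike.re_to_complex]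
    rw [← Complex.ofReal_re (Real.exp _), Complex.ofReal_exp]
    congr 2
    push_cast
    ring
  set I : ℝ := ∫ x : E, Real.exp (-‖x‖ ^ 2 / 2) with hI
  have hIpos : 0 < I := integral_exp_pos hint
  have hI' : (I : ℂ) = (Real.pi / (1 / 2 : ℂ)) ^ (Module.finrank ℝ E / 2 : ℂ) := by
    have h := hexp 0
    simp only [inner_zero_right, Complex.ofReal_zero, zero_mul, Complex.exp_zero, one_mul,
      norm_zero] at h
    rw [integral_complex_ofReal] at h
    rw [hI, h]
    simp
  refine ⟨I⁻¹, inv_pos.2 hIpos, ?_⟩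
  have hm : Measurable fun x : E => I⁻¹ * Real.exp (-‖x‖ ^ 2 / 2) := by fun_prop
  have hfin : IsFiniteMeasure
      ((volume : Measure E).withDensity (fun x => ENNReal.ofReal (I⁻¹ * Real.exp (-‖x‖ ^ 2 / 2)))) :=
    isFiniteMeasure_withDensity_ofReal (hint.const_mul I⁻¹).2
  refine Measure.ext_of_charFun ?_
  ext t
  rw [charFun_stdGaussian, charFun_apply, integral_withDensity_eq_integral_toReal_smul
    hm.ennreal_ofReal (ae_of_all _ fun x => ENNReal.ofReal_lt_top)]
  have hI0 : (I : ℂ) ≠ 0 := by exact_mod_cast hIpos.ne'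
  calc _ = (I : ℂ)⁻¹ * (I * Complex.exp (-‖t‖ ^ 2 / 2)) := by
        rw [← mul_assoc, inv_mul_cancel₀ hI0, one_mul]
    _ = (I : ℂ)⁻¹ * ∫ x : E, Complex.exp (inner ℝ x t * Complex.I) *
      (Real.exp (-‖x‖ ^ 2 / 2) : ℂ) := by rw [hexp, hI']
    _ = _ := by
        rw [← integral_const_mul]
        congr 1
        ext x
        rw [ENNReal.toReal_ofReal (by positivity), Complex.real_smul]
        push_cast
        ring

/-- The image of the standard Gaussian under a linear isomorphism has a Gaussian density with respect
to any additive Haar measure. -/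
lemma map_stdGaussian_eq_withDensity (e : E ≃L[ℝ] F) (ν : Measure F) [ν.IsAddHaarMeasure] :
    ∃ K : ℝ, 0 < K ∧ (stdGaussian E).map e =
      ν.withDensity (fun y => ENNReal.ofReal (K * Real.exp (-‖e.symm y‖ ^ 2 / 2))) := by
  obtain ⟨K, hK, hstd⟩ := stdGaussian_eq_withDensity E
  -- Uniqueness of Haar measure replaces the Jacobian determinant; only positivity of the factor
  -- matters.
  set c := ((volume : Measure E).map e).addHaarScalarFactor ν
  have hc : (volume : Measure E).map e = c • ν := Measure.isAddLeftInvariant_eq_smul _ _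
  have hcpos : 0 < c := Measure.addHaarScalarFactor_pos_of_isAddHaarMeasure _ _
  have hem : Measurable e := e.continuous.measurable
  have hes : Continuous e.symm := e.symm.continuous
  have hm : Measurable fun y : F => ENNReal.ofReal (K * Real.exp (-‖e.symm y‖ ^ 2 / 2)) :=
    (Continuous.measurable (by fun_prop)).ennreal_ofReal
  refine ⟨c * K, mul_pos (by exact_mod_cast hcpos) hK, ?_⟩
  ext s hs
  rw [Measure.map_apply hem hs, hstd, withDensity_apply _ (hem hs), withDensity_apply _ hs]
  have h := setLIntegral_map (μ := (volume : Measure E)) hs hm hem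
  simp only [ContinuousLinearEquiv.symm_apply_apply] at h
  rw [← h, hc, Measure.restrict_smul, lintegral_smul_measure, ENNReal.smul_def, smul_eq_mul,
    ← lintegral_const_mul _ hm]
  congr 1
  ext y
  rw [mul_assoc, ENNReal.ofReal_mul c.coe_nonneg, ENNReal.ofReal_coe_nnreal]

/-- A nondegenerate centered Gaussian is the image of the standard one under a linear isomorphism. -/
lemma exists_multivariateGaussian_eq_map {ι : Type*} [Fintype ι] [DecidableEq ι]
    {S : Matrix ι ι ℝ} (hS : S.PosDef) :
    ∃ e : EuclideanSpace ℝ ι ≃L[ℝ] EuclideanSpace ℝ ι,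
      multivariateGaussian 0 S = (stdGaussian (EuclideanSpace ℝ ι)).map e := by
  open scoped MatrixOrder in
  -- The Gaussian is the image of the standard one under `√S`, invertible because `S` is positive
  -- definite.
  have hu : IsUnit (CFC.sqrt S) := (Matrix.isStrictlyPositive_iff_posDef.2 hS).isUnit_cfcSqrt
  obtain ⟨u, hu⟩ := hu.map (Matrix.toEuclideanCLM (n := ι) (𝕜 := ℝ))
  refine ⟨ContinuousLinearEquiv.unitsEquiv ℝ _ u, ?_⟩
  rw [multivariateGaussian]
  congr 1
  ext1 x
  rw [zero_add, ← hu]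
  rfl

lemma IsGaussian.integrable_norm_clm_sq {μ : Measure F} [IsGaussian μ] {G : Type*}
    [NormedAddCommGroup G] [NormedSpace ℝ G] (L : F →L[ℝ] G) :
    Integrable (fun x => ‖L x‖ ^ 2) μ := by
  have : CompleteSpace F := FiniteDimensional.complete ℝ F
  exact (L.comp_memLp' (IsGaussian.memLp_two_id (μ := μ))).integrable_norm_pow (by norm_num)

end ProbabilityTheory

/-! ### Couplings and finiteness for the Gaussian problem -/

namespace GaussianEOT

variable {d : ℕ}

/-- Splitting of the coordinates of `ℝ^{2d}` into two blocks. -/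
noncomputable def splitCLE (d : ℕ) : EuclideanSpace ℝ (Fin d ⊕ Fin d) ≃L[ℝ]
    EuclideanSpace ℝ (Fin d) × EuclideanSpace ℝ (Fin d) :=
  LinearEquiv.toContinuousLinearEquiv
    { toFun := fun z => ((WithLp.toLp 2 fun i => z (Sum.inl i)), (WithLp.toLp 2 fun i => z (Sum.inr i)))
      invFun := fun p => WithLp.toLp 2 (Sum.elim p.1 p.2)
      map_add' := fun _ _ => rfl
      map_smul' := fun _ _ => rfl
      left_inv := fun z => by ext i; cases i <;> rfl
      right_inv := fun _ => rfl }

lemma gaussianProd_eq_map (S : Matrix (Fin d ⊕ Fin d) (Fin d ⊕ Fin d) ℝ) :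
    gaussianProd S = (multivariateGaussian 0 S).map (splitCLE d) := rfl

instance (A : Matrix (Fin d) (Fin d) ℝ) : IsGaussian (gaussian A) :=
  inferInstanceAs (IsGaussian (multivariateGaussian 0 A))

instance (S : Matrix (Fin d ⊕ Fin d) (Fin d ⊕ Fin d) ℝ) : IsGaussian (gaussianProd S) := by
  rw [gaussianProd_eq_map]
  infer_instance

lemma klDiv_prod_gaussianProd_ne_top {A B : Matrix (Fin d) (Fin d) ℝ}
    {S : Matrix (Fin d ⊕ Fin d) (Fin d ⊕ Fin d) ℝ} (hA : A.PosDef) (hB : B.PosDef)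
    (hS : S.PosDef) :
    klDiv ((gaussian A).prod (gaussian B)) (gaussianProd S) ≠ ∞ := by
  obtain ⟨a, ha⟩ := exists_multivariateGaussian_eq_map hA
  obtain ⟨b, hb⟩ := exists_multivariateGaussian_eq_map hB
  obtain ⟨s, hs⟩ := exists_multivariateGaussian_eq_map hS
  let ν : Measure (EuclideanSpace ℝ (Fin d)) := volume
  obtain ⟨Ka, hKa, ha'⟩ := map_stdGaussian_eq_withDensity a ν
  obtain ⟨Kb, hKb, hb'⟩ := map_stdGaussian_eq_withDensity b ν
  obtain ⟨Ks, hKs, hs'⟩ := map_stdGaussian_eq_withDensity (s.trans (splitCLE d)) (ν.prod ν)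
  have hρ : gaussianProd S = (ν.prod ν).withDensity fun z =>
      ENNReal.ofReal (Ks * Real.exp (-‖(s.trans (splitCLE d)).symm z‖ ^ 2 / 2)) := by
    rw [← hs', gaussianProd_eq_map, hs, Measure.map_map (splitCLE d).continuous.measurable
      s.continuous.measurable]
    rfl
  have hπ : (gaussian A).prod (gaussian B) = (ν.prod ν).withDensity fun z =>
      ENNReal.ofReal ((Ka * Real.exp (-‖a.symm z.1‖ ^ 2 / 2)) *
        (Kb * Real.exp (-‖b.symm z.2‖ ^ 2 / 2))) := by
    have ca := a.symm.continuous
    have cb := b.symm.continuous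
    rw [gaussian, gaussian, ha, hb, ha', hb', prod_withDensity
      (Continuous.measurable (by fun_prop)).ennreal_ofReal
      (Continuous.measurable (by fun_prop)).ennreal_ofReal]
    congr 1
    ext z
    exact (ENNReal.ofReal_mul (by positivity)).symm
  have hfin₁ : IsFiniteMeasure ((gaussian A).prod (gaussian B)) := inferInstance
  have hfin₂ : IsFiniteMeasure (gaussianProd S) := inferInstance
  have hint₁ := IsGaussian.integrable_norm_clm_sq (μ := (gaussian A).prod (gaussian B))
    ((a.symm : EuclideanSpace ℝ (Fin d) →L[ℝ] EuclideanSpace ℝ (Fin d)).comp (ContinuousLinearMap.fst ℝ _ _))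
  have hint₂ := IsGaussian.integrable_norm_clm_sq (μ := (gaussian A).prod (gaussian B))
    ((b.symm : EuclideanSpace ℝ (Fin d) →L[ℝ] EuclideanSpace ℝ (Fin d)).comp (ContinuousLinearMap.snd ℝ _ _))
  have hint₃ := IsGaussian.integrable_norm_clm_sq (μ := (gaussian A).prod (gaussian B))
    ((s.trans (splitCLE d)).symm : EuclideanSpace ℝ (Fin d) × EuclideanSpace ℝ (Fin d) →L[ℝ]
      EuclideanSpace ℝ (Fin d ⊕ Fin d))
  have hint := (((integrable_const (Real.log Ka + Real.log Kb - Real.log Ks)).sub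
    (hint₁.div_const 2)).sub (hint₂.div_const 2)).add (hint₃.div_const 2)
  rw [hπ] at hint hfin₁
  rw [hρ] at hfin₂
  rw [hπ, hρ]
  have ca := a.symm.continuous
  have cb := b.symm.continuous
  have cs := (s.trans (splitCLE d)).symm.continuous
  refine klDiv_withDensity_ne_top (Continuous.measurable (by fun_prop))
    (Continuous.measurable (by fun_prop)) (fun z => by positivity) (fun z => by positivity)
    (hint.congr (ae_of_all _ fun z => ?_))
  simp only [Pi.add_apply, Pi.sub_apply, ContinuousLinearMap.comp_apply,
    ContinuousLinearMap.coe_fst', ContinuousLinearMap.coe_snd', ContinuousLinearEquiv.coe_coe]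
  rw [Real.log_mul (by positivity) (by positivity), Real.log_mul hKa.ne' (by positivity),
    Real.log_mul hKb.ne' (by positivity), Real.log_mul hKs.ne' (by positivity), Real.log_exp,
    Real.log_exp, Real.log_exp]
  ring

lemma prod_mem_couplings (μ ν : Measure (EuclideanSpace ℝ (Fin d))) [IsProbabilityMeasure μ]
    [IsProbabilityMeasure ν] : μ.prod ν ∈ couplings μ ν :=
  ⟨inferInstance, by simp, by simp⟩

lemma midpoint_mem_couplings {μ ν : Measure (EuclideanSpace ℝ (Fin d))}
    {π₁ π₂ : Measure (EuclideanSpace ℝ (Fin d) × EuclideanSpace ℝ (Fin d))}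
    (h₁ : π₁ ∈ couplings μ ν) (h₂ : π₂ ∈ couplings μ ν) :
    (2⁻¹ : ℝ≥0∞) • (π₁ + π₂) ∈ couplings μ ν := by
  obtain ⟨p₁, f₁, s₁⟩ := h₁
  obtain ⟨p₂, f₂, s₂⟩ := h₂
  have key : ∀ η : Measure (EuclideanSpace ℝ (Fin d)), (2⁻¹ : ℝ≥0∞) • (η + η) = η := by
    intro η
    rw [← two_smul ℝ≥0∞ η, smul_smul, ENNReal.inv_mul_cancel (by norm_num) (by norm_num), one_smul]
  refine ⟨⟨?_⟩, ?_, ?_⟩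
  · simp [ENNReal.inv_two_add_inv_two]
  · rw [Measure.map_smul, Measure.map_add _ _ measurable_fst, f₁, f₂, key]
  · rw [Measure.map_smul, Measure.map_add _ _ measurable_snd, s₁, s₂, key]

/-- A marginal evaluates the coupling on preimages of measurable sets, where setwise convergence
applies directly. -/
lemma mem_couplings_of_tendsto {μ ν : Measure (EuclideanSpace ℝ (Fin d))}
    {u : ℕ → Measure (EuclideanSpace ℝ (Fin d) × EuclideanSpace ℝ (Fin d))}
    {π : Measure (EuclideanSpace ℝ (Fin d) × EuclideanSpace ℝ (Fin d))}
    (hu : ∀ n, u n ∈ couplings μ ν)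
    (h : ∀ s, MeasurableSet s → Tendsto (fun n => u n s) atTop (𝓝 (π s))) :
    π ∈ couplings μ ν := by
  refine ⟨⟨?_⟩, ?_, ?_⟩
  · refine tendsto_nhds_unique (h _ MeasurableSet.univ) ?_
    simp_rw [fun n => (hu n).1.measure_univ]
    exact tendsto_const_nhds
  · ext s hs
    rw [Measure.map_apply measurable_fst hs]
    refine tendsto_nhds_unique (h _ (measurable_fst hs)) ?_
    simp_rw [← fun n => Measure.map_apply (μ := u n) measurable_fst hs, fun n => (hu n).2.1]
    exact tendsto_const_nhds
  · ext s hs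
    rw [Measure.map_apply measurable_snd hs]
    refine tendsto_nhds_unique (h _ (measurable_snd hs)) ?_
    simp_rw [← fun n => Measure.map_apply (μ := u n) measurable_snd hs, fun n => (hu n).2.2]
    exact tendsto_const_nhds

lemma objective_prod_ne_top {A B : Matrix (Fin d) (Fin d) ℝ}
    {S : Matrix (Fin d ⊕ Fin d) (Fin d ⊕ Fin d) ℝ} (hA : A.PosDef) (hB : B.PosDef)
    (hS : S.PosDef) (ε : ℝ) :
    objective ε (gaussianProd S) ((gaussian A).prod (gaussian B)) ≠ ∞ := by
  refine ENNReal.add_ne_top.2 ⟨?_, ENNReal.mul_ne_top ENNReal.ofReal_ne_top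
    (klDiv_prod_gaussianProd_ne_top hA hB hS)⟩
  have h := IsGaussian.integrable_norm_clm_sq (μ := (gaussian A).prod (gaussian B))
    (ContinuousLinearMap.fst ℝ (EuclideanSpace ℝ (Fin d)) (EuclideanSpace ℝ (Fin d)) -
      ContinuousLinearMap.snd ℝ _ _)
  exact h.lintegral_lt_top.ne

end GaussianEOT

theorem mainTheorem7 {d : ℕ} (A B : Matrix (Fin d) (Fin d) ℝ)
    (S : Matrix (Fin d ⊕ Fin d) (Fin d ⊕ Fin d) ℝ)
    (hA : A.PosDef) (hB : B.PosDef) (hS : S.PosDef) (ε : ℝ) (hε : 0 < ε) :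
    ∃! π : MeasureTheory.Measure (EuclideanSpace ℝ (Fin d) × EuclideanSpace ℝ (Fin d)),
      GaussianEOT.IsSolution ε (GaussianEOT.gaussianProd S)
        (GaussianEOT.gaussian A) (GaussianEOT.gaussian B) π := by
  refine existsUnique_isMinOn_lintegral_add_klDiv (GaussianEOT.gaussianProd S)
    (c := fun p => ENNReal.ofReal (‖p.1 - p.2‖ ^ 2)) (k := ENNReal.ofReal (2 * ε))
    (by fun_prop) (fun _ => ENNReal.ofReal_ne_top) (by simpa using hε) ENNReal.ofReal_ne_top
    (GaussianEOT.couplings (GaussianEOT.gaussian A) (GaussianEOT.gaussian B))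
    (fun π hπ => hπ.1) (fun _ h₁ _ h₂ => GaussianEOT.midpoint_mem_couplings h₁ h₂)
    (fun _ _ hu h => GaussianEOT.mem_couplings_of_tendsto hu h)
    ⟨_, GaussianEOT.prod_mem_couplings _ _, GaussianEOT.objective_prod_ne_top hA hB hS ε⟩
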